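/- Let $\lambda\in\mathbb{C}$, $\lambda\neq 0$, and let $\mathbb{R}^3_\lambda$ be the unital complex algebra generated by $x_1,x_2,x_3$ with relations $[x_a,x_b]=\imath\lambda\,\epsilon_{abc}x_c$ (so $\mathbb{R}^3_\lambda\cong U(\mathfrak{su}(2))$), with the coproduct $\Delta x_a=x_a\otimes 1+1\otimes x_a$ (written $\Delta f=\sum f_{(1)}\otimes f_{(2)}$) and counit $\epsilon(x_a)=0$. Let $\sigma_1,\sigma_2,\sigma_3$ be the Pauli matrices and $\rho:\mathbb{R}^3_\lambda\to M_2(\mathbb{C})$ the algebra map with $\rho(x_a)=\frac{\lambda}{2}\sigma_a$. Let $\Omega=\bigoplus_k\Omega^k$, $\Omega^k=\Lambda^k(M_2(\mathbb{C}))\otimes\mathbb{R}^3_\lambda$, be the algebra generated by the exterior algebra $\Lambda(M_2(\mathbb{C}))$ on the space of basic 1-forms $M_2(\mathbb{C})$ and by $\mathbb{R}^3_\lambda$, with the cross relations $x_a\,m=m\,x_a+\rho(x_a)m$ for $m\in M_2(\mathbb{C})$ (matrix product in the last term). Put $\theta=\mathrm{id}\in M_2(\mathbb{C})$. The exterior derivative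 is $$\mathrm{d}f=\lambda^{-1}\sum\rho\big(f_{(1)}-\epsilon(f_{(1)})1\big)\,f_{(2)},\qquad \mathrm{d}(m f)=m\wedge \mathrm{d}f\qquad (f\in\mathbb{R}^3_\lambda,\ m\in\Lambda(M_2(\mathbb{C}))),$$ so that $\mathrm{d}x_a=\frac12\sigma_a$, $\mathrm{d}\omega=\lambda^{-1}\big(\omega\wedge\theta-(-1)^{\deg\omega}\theta\wedge\omega\big)$ and $\mathrm{d}^2=0$; the 1-forms $\mathrm{d}x_1,\mathrm{d}x_2,\mathrm{d}x_3,\theta$ are a basis of $M_2(\mathbb{C})$. Let $H^k$ be the space of closed $k$-forms modulo exact $k$-forms. **Theorem.** $H^0=\mathbb{C}\cdot 1$, $H^1=\mathbb{C}\cdot\theta$ (each one-dimensional, spanned by the nonzero class of $1$, respectively of $\theta$), and $H^2=H^3=H^4=\{0\}$. -/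

import Mathlib

open scoped TensorProduct

noncomputable section

namespace QuantumR3

/-! ### The coordinate algebra and its Hopf algebra structure -/

/-- The defining relations `[x_a, x_{a+1}] = i λ x_{a+2}` (indices mod 3), that is
`[x_a, x_b] = i λ ε_{abc} x_c`. -/
inductive Rel (lam : ℂ) : FreeAlgebra ℂ (Fin 3) → FreeAlgebra ℂ (Fin 3) → Prop
  | comm (a : Fin 3) :
      Rel lam (FreeAlgebra.ι ℂ a * FreeAlgebra.ι ℂ (a + 1))
        (FreeAlgebra.ι ℂ (a + 1) * FreeAlgebra.ι ℂ a
          + (Complex.I * lam) • FreeAlgebra.ι ℂ (a + 2))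

/-- The algebra `ℝ³_λ`: the unital complex algebra generated by `x_1, x_2, x_3` (here indexed by
`Fin 3`) with relations `[x_a, x_b] = i λ ε_{abc} x_c`. -/
def R3 (lam : ℂ) : Type := RingQuot (Rel lam)

instance (lam : ℂ) : Ring (R3 lam) := inferInstanceAs (Ring (RingQuot (Rel lam)))

instance (lam : ℂ) : Algebra ℂ (R3 lam) := inferInstanceAs (Algebra ℂ (RingQuot (Rel lam)))

variable (lam : ℂ)

/-- The generators `x_a`. -/
def x (a : Fin 3) : R3 lam := RingQuot.mkAlgHom ℂ (Rel lam) (FreeAlgebra.ι ℂ a)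

lemma x_comm (a : Fin 3) :
    x lam a * x lam (a + 1) = x lam (a + 1) * x lam a + (Complex.I * lam) • x lam (a + 2) := by
  have h := RingQuot.mkAlgHom_rel ℂ (Rel.comm (lam := lam) a)
  rw [map_add, map_mul, map_mul, map_smul] at h
  exact h

/-- The universal property of `ℝ³_λ`. -/
def lift {A : Type*} [Ring A] [Algebra ℂ A] (y : Fin 3 → A)
    (h : ∀ a, y a * y (a + 1) = y (a + 1) * y a + (Complex.I * lam) • y (a + 2)) :
    R3 lam →ₐ[ℂ] A :=
  RingQuot.liftAlgHom ℂ ⟨FreeAlgebra.lift ℂ y, by rintro _ _ ⟨a⟩; simpa using h a⟩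

@[simp]
lemma lift_x {A : Type*} [Ring A] [Algebra ℂ A] (y : Fin 3 → A)
    (h : ∀ a, y a * y (a + 1) = y (a + 1) * y a + (Complex.I * lam) • y (a + 2)) (a : Fin 3) :
    lift lam y h (x lam a) = y a := by
  refine (RingQuot.liftAlgHom_mkAlgHom_apply ℂ _ _ _).trans ?_
  simp

/-- Induction on elements of `ℝ³_λ`. -/
lemma R3_induction {P : R3 lam → Prop} (one : P 1) (gen : ∀ a, P (x lam a))
    (smul : ∀ (c : ℂ) f, P f → P (c • f)) (add : ∀ f g, P f → P g → P (f + g))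
    (mul : ∀ f g, P f → P g → P (f * g)) (f : R3 lam) : P f := by
  obtain ⟨p, rfl⟩ := RingQuot.mkAlgHom_surjective ℂ (Rel lam) f
  induction p using FreeAlgebra.induction with
  | grade0 r =>
    rw [AlgHom.commutes, Algebra.algebraMap_eq_smul_one]
    exact smul r _ one
  | grade1 a => exact gen a
  | mul a b ha hb => rw [map_mul]; exact mul _ _ ha hb
  | add a b ha hb => rw [map_add]; exact add _ _ ha hb

/-- The coproduct, `Δ x_a = x_a ⊗ 1 + 1 ⊗ x_a`. -/
def comul : R3 lam →ₐ[ℂ] R3 lam ⊗[ℂ] R3 lam :=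
  lift lam (fun a => x lam a ⊗ₜ 1 + 1 ⊗ₜ x lam a) (by
    intro a
    simp only [mul_add, add_mul, Algebra.TensorProduct.tmul_mul_tmul, one_mul, mul_one, x_comm,
      TensorProduct.add_tmul, TensorProduct.tmul_add, smul_add, TensorProduct.smul_tmul',
      TensorProduct.tmul_smul]
    abel)

lemma comul_x (a : Fin 3) : comul lam (x lam a) = x lam a ⊗ₜ 1 + 1 ⊗ₜ x lam a := by
  simp [comul]

/-- The counit, `ε x_a = 0`. -/
def counit : R3 lam →ₐ[ℂ] ℂ := lift lam (fun _ => 0) (by simp)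

/-! ### The basic 1-forms -/

/-- The space `M₂(ℂ)` of basic (invariant) 1-forms. -/
abbrev M2 : Type := Matrix (Fin 2) (Fin 2) ℂ

/-- The Pauli matrices. -/
def pauli : Fin 3 → M2 :=
  ![!![0, 1; 1, 0], !![0, -Complex.I; Complex.I, 0], !![1, 0; 0, -1]]

lemma pauli_mul (a : Fin 3) :
    pauli a * pauli (a + 1) = pauli (a + 1) * pauli a + (2 * Complex.I) • pauli (a + 2) := by
  fin_cases a <;> ext i j <;> fin_cases i <;> fin_cases j <;>
    simp [pauli, Matrix.mul_apply, Fin.sum_univ_two] <;> ring_nf <;> simp <;> norm_num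

lemma half_pauli_comm (a : Fin 3) :
    ((lam / 2) • pauli a) * ((lam / 2) • pauli (a + 1)) =
      ((lam / 2) • pauli (a + 1)) * ((lam / 2) • pauli a)
        + (Complex.I * lam) • (lam / 2) • pauli (a + 2) := by
  simp only [smul_mul_smul_comm, pauli_mul, smul_add, smul_smul]
  congr 2
  ring

/-- The representation `ρ : ℝ³_λ → M₂(ℂ)`, `ρ(x_a) = (λ/2) σ_a`. -/
def rho : R3 lam →ₐ[ℂ] M2 := lift lam (fun a => (lam / 2) • pauli a) (half_pauli_comm lam)

/-- The exterior algebra of the space `M₂(ℂ)` of basic 1-forms. -/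
abbrev Lam : Type := ExteriorAlgebra ℂ M2

/-- The algebra map `m ↦ m + ε (A m)` from the exterior algebra of `M₂(ℂ)` to the dual numbers
over it. -/
def derHom (A : M2) : Lam →ₐ[ℂ] TrivSqZeroExt Lam Lam :=
  ExteriorAlgebra.lift ℂ
    ⟨(TrivSqZeroExt.inlAlgHom ℂ Lam Lam).toLinearMap ∘ₗ ExteriorAlgebra.ι ℂ
      + (TrivSqZeroExt.inrHom Lam Lam).restrictScalars ℂ ∘ₗ ExteriorAlgebra.ι ℂ ∘ₗ
        LinearMap.mulLeft ℂ A, by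
      intro m
      ext
      · simp
      · simp [ExteriorAlgebra.ι_add_mul_swap]⟩

/-- The derivation of the exterior algebra that extends the left multiplication `m ↦ A m` on
`M₂(ℂ)`, as the `ε`-part of `derHom`. -/
def der (A : M2) : Module.End ℂ Lam :=
  (TrivSqZeroExt.sndHom Lam Lam).restrictScalars ℂ ∘ₗ (derHom A).toLinearMap

@[simp]
lemma der_ι (A m : M2) : der A (ExteriorAlgebra.ι ℂ m) = ExteriorAlgebra.ι ℂ (A * m) := by
  simp [der, derHom]

@[simp]
lemma der_one (A : M2) : der A 1 = 0 := by
  simp [der, derHom]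

lemma der_mul (A : M2) (u v : Lam) : der A (u * v) = der A u * v + u * der A v := by
  have key : ∀ w : Lam, (derHom A w).fst = w := by
    intro w
    induction w using ExteriorAlgebra.induction with
    | algebraMap r => rw [AlgHom.commutes]; rfl
    | ι m => simp [derHom]
    | mul a b ha hb => simp only [map_mul, TrivSqZeroExt.fst_mul, ha, hb]
    | add a b ha hb => simp only [map_add, TrivSqZeroExt.fst_add, ha, hb]
  simp only [der, LinearMap.comp_apply, AlgHom.toLinearMap_apply, map_mul,
    LinearMap.coe_restrictScalars, TrivSqZeroExt.sndHom_apply, TrivSqZeroExt.snd_mul, key]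
  simp [add_comm]

/-- Two derivations of the exterior algebra that agree on `M₂(ℂ)` are equal. -/
lemma end_ext_of_derivation {D E : Module.End ℂ Lam}
    (hD : ∀ u v, D (u * v) = D u * v + u * D v) (hE : ∀ u v, E (u * v) = E u * v + u * E v)
    (h : ∀ m, D (ExteriorAlgebra.ι ℂ m) = E (ExteriorAlgebra.ι ℂ m)) : D = E := by
  have one : ∀ {F : Module.End ℂ Lam}, (∀ u v, F (u * v) = F u * v + u * F v) → F 1 = 0 := by
    intro F hF
    simpa using hF 1 1
  refine LinearMap.ext fun w => ?_
  induction w using ExteriorAlgebra.induction with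
  | algebraMap r => rw [Algebra.algebraMap_eq_smul_one, map_smul, map_smul, one hD, one hE]
  | ι m => exact h m
  | mul a b ha hb => rw [hD, hE, ha, hb]
  | add a b ha hb => rw [map_add, map_add, ha, hb]

lemma der_comm (a : Fin 3) :
    der ((lam / 2) • pauli a) * der ((lam / 2) • pauli (a + 1)) =
      der ((lam / 2) • pauli (a + 1)) * der ((lam / 2) • pauli a)
        + (Complex.I * lam) • der ((lam / 2) • pauli (a + 2)) := by
  rw [← sub_eq_iff_eq_add']
  apply end_ext_of_derivation
  · intro u v
    simp only [LinearMap.sub_apply, Module.End.mul_apply, der_mul, map_add]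
    noncomm_ring
  · intro u v
    simp only [LinearMap.smul_apply, der_mul, smul_add, smul_mul_assoc, mul_smul_comm]
  · intro m
    simp only [LinearMap.sub_apply, Module.End.mul_apply, der_ι, LinearMap.smul_apply]
    rw [← map_sub, ← map_smul, ← mul_assoc, ← mul_assoc, half_pauli_comm, add_mul,
      add_sub_cancel_left, smul_mul_assoc]

/-- The action of `ℝ³_λ` on the exterior algebra of `M₂(ℂ)`: on `M₂(ℂ)` it is left multiplication
by `ρ(f)`, and the primitive elements `x_a` act by derivations. -/
def act : R3 lam →ₐ[ℂ] Module.End ℂ Lam :=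
  lift lam (fun a => der ((lam / 2) • pauli a)) (der_comm lam)

lemma act_x (a : Fin 3) : act lam (x lam a) = der ((lam / 2) • pauli a) := by simp [act]

lemma act_one_form (f : R3 lam) (m : M2) :
    act lam f (ExteriorAlgebra.ι ℂ m) = ExteriorAlgebra.ι ℂ (rho lam f * m) := by
  induction f using R3_induction generalizing m with
  | one => simp
  | gen a => simp [act_x, rho]
  | smul c f hf => simp [hf]
  | add f g hf hg => simp [hf, hg, add_mul]
  | mul f g hf hg => simp [hf, hg, mul_assoc]

/-! ### The exterior algebra of differential forms -/

/-- The space `Ω = Λ(M₂(ℂ)) ⊗ ℝ³_λ` of differential forms; `m ⊗ f` is the form `m f`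
(coefficients on the right). -/
def Forms : Type := Lam ⊗[ℂ] R3 lam

instance : AddCommGroup (Forms lam) := inferInstanceAs (AddCommGroup (Lam ⊗[ℂ] R3 lam))

instance : Module ℂ (Forms lam) := inferInstanceAs (Module ℂ (Lam ⊗[ℂ] R3 lam))

/-- The form `m f`, as a bilinear map. -/
def form : Lam →ₗ[ℂ] R3 lam →ₗ[ℂ] Forms lam := TensorProduct.mk ℂ Lam (R3 lam)

lemma forms_induction {P : Forms lam → Prop} (zero : P 0) (form : ∀ m f, P (form lam m f))
    (add : ∀ ω η, P ω → P η → P (ω + η)) (ω : Forms lam) : P ω :=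
  TensorProduct.induction_on (motive := P) ω zero form add

/-- Left multiplication of forms by functions, `f (n g) = (f₁ ▷ n) (f₂ g)`. -/
def leftMul : R3 lam →ₐ[ℂ] Module.End ℂ (Forms lam) :=
  ((Module.endTensorEndAlgHom (R := ℂ) (S := ℂ) (A := ℂ) (M := Lam) (N := R3 lam)).comp
    (Algebra.TensorProduct.map (act lam) (Algebra.lmul ℂ (R3 lam)))).comp (comul lam)

lemma leftMul_x (a : Fin 3) (n : Lam) (g : R3 lam) :
    leftMul lam (x lam a) (form lam n g) =
      form lam (der ((lam / 2) • pauli a) n) g + form lam n (x lam a * g) := by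
  change Module.endTensorEndAlgHom (R := ℂ) (S := ℂ) (A := ℂ) (M := Lam) (N := R3 lam)
    (Algebra.TensorProduct.map (act lam) (Algebra.lmul ℂ (R3 lam)) (comul lam (x lam a)))
      (n ⊗ₜ[ℂ] g) = der ((lam / 2) • pauli a) n ⊗ₜ[ℂ] g + n ⊗ₜ[ℂ] (x lam a * g)
  simp [comul_x, Module.endTensorEndAlgHom_apply, act_x]

/-- Left multiplication of forms by elements of the exterior algebra, `m (n g) = (m ∧ n) g`. -/
def wedgeLeft : Lam →ₐ[ℂ] Module.End ℂ (Forms lam) :=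
  (Module.endTensorEndAlgHom (R := ℂ) (S := ℂ) (A := ℂ) (M := Lam) (N := R3 lam)).comp
    (Algebra.TensorProduct.includeLeft.comp (Algebra.lmul ℂ Lam))

@[simp]
lemma wedgeLeft_form (m n : Lam) (g : R3 lam) :
    wedgeLeft lam m (form lam n g) = form lam (m * n) g := by
  rfl

/-- The product of forms: `(m f) (n g) = (m ∧ (f₁ ▷ n)) (f₂ g)`. -/
def mulMap : Forms lam →ₗ[ℂ] Module.End ℂ (Forms lam) :=
  TensorProduct.lift
    ((LinearMap.mul ℂ (Module.End ℂ (Forms lam))).compl₁₂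
      (wedgeLeft lam).toLinearMap (leftMul lam).toLinearMap)

@[simp]
lemma mulMap_form (m : Lam) (f : R3 lam) (ω : Forms lam) :
    mulMap lam (form lam m f) ω = wedgeLeft lam m (leftMul lam f ω) := rfl

lemma leftMul_form_one (f g : R3 lam) : leftMul lam f (form lam 1 g) = form lam 1 (f * g) := by
  induction f using R3_induction generalizing g with
  | one => simp
  | gen a => simp [leftMul_x]
  | smul c f hf => simp [hf]
  | add f g hf hg => simp [hf, hg, add_mul]
  | mul f g hf hg => simp [hf, hg, mul_assoc]

lemma mulMap_wedgeLeft (m : Lam) (ω η : Forms lam) :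
    mulMap lam (wedgeLeft lam m ω) η = wedgeLeft lam m (mulMap lam ω η) := by
  induction ω using forms_induction with
  | zero => simp
  | form n g => simp
  | add a b ha hb => simp [ha, hb]

lemma leftMul_x_wedgeLeft (a : Fin 3) (m : Lam) (ω : Forms lam) :
    leftMul lam (x lam a) (wedgeLeft lam m ω) =
      wedgeLeft lam (der ((lam / 2) • pauli a) m) ω
        + wedgeLeft lam m (leftMul lam (x lam a) ω) := by
  induction ω using forms_induction with
  | zero => simp
  | form n g => simp [leftMul_x, der_mul, add_assoc]
  | add b c hb hc => simp only [map_add, hb, hc]; abel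

lemma mulMap_leftMul (f : R3 lam) (ω η : Forms lam) :
    mulMap lam (leftMul lam f ω) η = leftMul lam f (mulMap lam ω η) := by
  induction f using R3_induction generalizing ω with
  | one => simp
  | gen a =>
    induction ω using forms_induction with
    | zero => simp
    | form n g => simp [leftMul_x, leftMul_x_wedgeLeft]
    | add b c hb hc => simp [hb, hc]
  | smul c f hf => simp [hf]
  | add f g hf hg => simp [hf, hg]
  | mul f g hf hg => simp [hf, hg]

lemma mulMap_assoc (ω η ζ : Forms lam) :
    mulMap lam (mulMap lam ω η) ζ = mulMap lam ω (mulMap lam η ζ) := by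
  induction ω using forms_induction with
  | zero => simp
  | form m f => simp [mulMap_wedgeLeft, mulMap_leftMul]
  | add a b ha hb => simp [ha, hb]

/-- The algebra of differential forms `Ω`: generated by the exterior algebra of `M₂(ℂ)` and by
`ℝ³_λ`, with cross relations `f m = (f₁ ▷ m) f₂`. -/
instance : Ring (Forms lam) :=
  { (inferInstance : AddCommGroup (Forms lam)) with
    mul := fun ω η => mulMap lam ω η
    one := form lam 1 1
    mul_assoc := mulMap_assoc lam
    one_mul := fun ω => by
      change mulMap lam (form lam 1 1) ω = ω
      simp
    mul_one := fun ω => by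
      change mulMap lam ω (form lam 1 1) = ω
      induction ω using forms_induction with
      | zero => simp
      | form m f => simp [leftMul_form_one]
      | add a b ha hb => simp [ha, hb]
    left_distrib := fun ω η ζ => map_add (mulMap lam ω) η ζ
    right_distrib := fun ω η ζ => by
      change mulMap lam (ω + η) ζ = mulMap lam ω ζ + mulMap lam η ζ
      simp
    zero_mul := fun ω => by
      change mulMap lam 0 ω = 0
      simp
    mul_zero := fun ω => map_zero (mulMap lam ω) }

lemma mul_def (ω η : Forms lam) : ω * η = mulMap lam ω η := rfl

lemma one_def : (1 : Forms lam) = form lam 1 1 := rfl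

instance : Algebra ℂ (Forms lam) :=
  Algebra.ofModule
    (fun c ω η => by rw [mul_def, mul_def, map_smul, LinearMap.smul_apply])
    (fun c ω η => by rw [mul_def, mul_def, map_smul])

lemma form_mul_form_one (m n : Lam) (g : R3 lam) :
    form lam m 1 * form lam n g = form lam (m * n) g := by
  simp [mul_def]

lemma form_mul_fun (m : Lam) (f g : R3 lam) :
    form lam m f * form lam 1 g = form lam m (f * g) := by
  simp [mul_def, leftMul_form_one]

/-- The inclusion of the functions `ℝ³_λ` in the algebra of forms. -/
def ofFun : R3 lam →ₐ[ℂ] Forms lam :=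
  AlgHom.ofLinearMap (form lam 1) rfl (fun f g => (form_mul_fun lam 1 f g).symm)

/-- The inclusion of the exterior algebra of basic forms in the algebra of forms. -/
def ofBasic : Lam →ₐ[ℂ] Forms lam :=
  AlgHom.ofLinearMap ((form lam).flip 1) rfl (fun m n => (form_mul_form_one lam m n 1).symm)

/-- The basic 1-form given by a matrix. -/
def basicOneForm (m : M2) : Forms lam := ofBasic lam (ExteriorAlgebra.ι ℂ m)

/-- The basic 1-form `θ`, given by the identity matrix. -/
def theta : Forms lam := basicOneForm lam 1

lemma ofBasic_mul_ofFun (m : Lam) (f : R3 lam) : ofBasic lam m * ofFun lam f = form lam m f := by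
  refine (form_mul_form_one lam m 1 f).trans ?_
  rw [mul_one]

/-- The space `Ω^k = Λ^k(M₂(ℂ)) ⊗ ℝ³_λ` of `k`-forms. -/
def kForms (k : ℕ) : Submodule ℂ (Forms lam) :=
  Submodule.span ℂ {ω | ∃ m ∈ ⋀[ℂ]^k M2, ∃ f : R3 lam, ω = ofBasic lam m * ofFun lam f}

/-! ### The exterior derivative -/

/-- The exterior derivative of functions,
`d f = λ⁻¹ ∑ ρ(f₁ - ε(f₁) 1) f₂`. -/
def dFun : R3 lam →ₗ[ℂ] Forms lam :=
  lam⁻¹ • (TensorProduct.lift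
    ((form lam).comp (ExteriorAlgebra.ι ℂ ∘ₗ
      ((rho lam).toLinearMap - Algebra.linearMap ℂ M2 ∘ₗ (counit lam).toLinearMap))))
    ∘ₗ (comul lam).toLinearMap

lemma dFun_apply (f : R3 lam) :
    dFun lam f = lam⁻¹ • TensorProduct.lift
      ((form lam).comp (ExteriorAlgebra.ι ℂ ∘ₗ
        ((rho lam).toLinearMap - Algebra.linearMap ℂ M2 ∘ₗ (counit lam).toLinearMap)))
      (comul lam f) := rfl

/-- The exterior derivative on all forms, `d (m f) = m ∧ d f` for `m` in the exterior algebra of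
basic forms. -/
def d : Forms lam →ₗ[ℂ] Forms lam :=
  TensorProduct.lift ((LinearMap.mul ℂ (Forms lam)).compl₁₂ (ofBasic lam).toLinearMap (dFun lam))

lemma d_form (m : Lam) (f : R3 lam) :
    d lam (ofBasic lam m * ofFun lam f) = ofBasic lam m * dFun lam f := by
  rw [ofBasic_mul_ofFun]
  rfl

/-! ### Basic properties of the exterior derivative -/

lemma counit_x (a : Fin 3) : counit lam (x lam a) = 0 := by simp [counit]

lemma rho_x (a : Fin 3) : rho lam (x lam a) = (lam / 2) • pauli a := by simp [rho]

lemma counit_comul (f : R3 lam) :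
    Algebra.TensorProduct.lid ℂ (R3 lam)
      (Algebra.TensorProduct.map (counit lam) (AlgHom.id ℂ (R3 lam)) (comul lam f)) = f := by
  induction f using R3_induction with
  | one => simp
  | gen a => simp [comul_x, counit_x]
  | smul c f hf => simp only [map_smul, hf]
  | add f g hf hg => simp only [map_add, hf, hg]
  | mul f g hf hg => simp only [map_mul, hf, hg]

lemma ofFun_mul_theta (f : R3 lam) :
    ofFun lam f * theta lam =
      TensorProduct.lift ((form lam).comp (ExteriorAlgebra.ι ℂ ∘ₗ (rho lam).toLinearMap))
        (comul lam f) := by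
  have key : ∀ T : R3 lam ⊗[ℂ] R3 lam,
      Module.endTensorEndAlgHom (R := ℂ) (S := ℂ) (A := ℂ) (M := Lam) (N := R3 lam)
        (Algebra.TensorProduct.map (act lam) (Algebra.lmul ℂ (R3 lam)) T)
        (ExteriorAlgebra.ι ℂ (1 : M2) ⊗ₜ[ℂ] (1 : R3 lam)) =
      TensorProduct.lift ((form lam).comp (ExteriorAlgebra.ι ℂ ∘ₗ (rho lam).toLinearMap)) T := by
    intro T
    induction T using TensorProduct.induction_on with
    | zero => simp only [map_zero]; rfl
    | tmul a b =>
      simp [Module.endTensorEndAlgHom_apply, act_one_form]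
      rfl
    | add a b ha hb =>
      simp only [map_add, LinearMap.add_apply, ha, hb]
      rfl
  rw [← key]
  change mulMap lam (form lam 1 f) (form lam (ExteriorAlgebra.ι ℂ 1) 1) = _
  rw [mulMap_form, map_one, Module.End.one_apply]
  rfl

lemma theta_mul_ofFun (f : R3 lam) :
    theta lam * ofFun lam f =
      TensorProduct.lift ((form lam).comp (ExteriorAlgebra.ι ℂ ∘ₗ
        (Algebra.linearMap ℂ M2 ∘ₗ (counit lam).toLinearMap))) (comul lam f) := by
  have key : ∀ T : R3 lam ⊗[ℂ] R3 lam,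
      TensorProduct.lift ((form lam).comp (ExteriorAlgebra.ι ℂ ∘ₗ
        (Algebra.linearMap ℂ M2 ∘ₗ (counit lam).toLinearMap))) T =
      form lam (ExteriorAlgebra.ι ℂ 1) (Algebra.TensorProduct.lid ℂ (R3 lam)
        (Algebra.TensorProduct.map (counit lam) (AlgHom.id ℂ (R3 lam)) T)) := by
    intro T
    induction T using TensorProduct.induction_on with
    | zero => simp
    | tmul a b => simp [Algebra.algebraMap_eq_smul_one]
    | add a b ha hb => simp only [map_add, ha, hb]
  rw [key, counit_comul, theta, basicOneForm, ofBasic_mul_ofFun]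

/-- On functions, `d` is the commutator with `λ⁻¹ θ`. -/
lemma dFun_eq (f : R3 lam) :
    dFun lam f = lam⁻¹ • (ofFun lam f * theta lam - theta lam * ofFun lam f) := by
  rw [ofFun_mul_theta, theta_mul_ofFun, dFun_apply, ← LinearMap.sub_apply]
  congr 2
  ext a b
  simp

/-- `d x_a = σ_a / 2`. -/
lemma d_x (hlam : lam ≠ 0) (a : Fin 3) :
    d lam (ofFun lam (x lam a)) = basicOneForm lam ((1 / 2 : ℂ) • pauli a) := by
  have h := d_form lam 1 (x lam a)
  rw [map_one, one_mul, one_mul] at h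
  rw [h, dFun_eq, ofFun_mul_theta, theta_mul_ofFun]
  have hc : lam⁻¹ * (lam / 2) = 1 / 2 := by field_simp
  simp [comul_x, rho_x, counit_x, basicOneForm, smul_smul, hc]
  rfl

/-- The commutation relations between functions and basic 1-forms. -/
lemma x_mul_basicOneForm (a : Fin 3) (m : M2) :
    ofFun lam (x lam a) * basicOneForm lam m =
      basicOneForm lam m * ofFun lam (x lam a)
        + basicOneForm lam (((lam / 2) • pauli a) * m) := by
  have h := leftMul_x lam a (ExteriorAlgebra.ι ℂ m) 1
  rw [der_ι, mul_one, ← ofBasic_mul_ofFun, ← ofBasic_mul_ofFun, ← ofBasic_mul_ofFun, map_one,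
    mul_one, mul_one] at h
  rw [basicOneForm, basicOneForm, add_comm, ← h]
  change mulMap lam (form lam 1 (x lam a)) _ = _
  rw [mulMap_form, map_one, Module.End.one_apply]

lemma theta_mul_theta : theta lam * theta lam = 0 := by
  rw [theta, basicOneForm, ← map_mul, ExteriorAlgebra.ι_sq_zero, map_zero]

lemma ι_mul_of_mem (v : M2) (k : ℕ) {m : Lam} (hm : m ∈ ⋀[ℂ]^k M2) :
    m * ExteriorAlgebra.ι ℂ v = (-1 : ℂ) ^ k • (ExteriorAlgebra.ι ℂ v * m) := by
  induction k generalizing m with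
  | zero =>
    rw [ExteriorAlgebra.exteriorPower, pow_zero] at hm
    obtain ⟨c, rfl⟩ := Submodule.mem_one.mp hm
    simp [Algebra.commutes]
  | succ k ih =>
    rw [ExteriorAlgebra.exteriorPower, pow_succ] at hm
    induction hm using Submodule.mul_induction_on' with
    | mem_mul_mem u hu w hw =>
      obtain ⟨w, rfl⟩ := hw
      have hvw := ExteriorAlgebra.ι_add_mul_swap (R := ℂ) w v
      rw [mul_assoc, eq_neg_of_add_eq_zero_left hvw, mul_neg, ← mul_assoc, ih hu, ← mul_assoc,
        pow_succ, smul_mul_assoc]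
      simp
    | add a _ b _ ha hb => rw [add_mul, ha, hb, mul_add, smul_add]

/-- The exterior derivative is the graded commutator with `λ⁻¹ θ`. -/
lemma d_eq_of_mem (k : ℕ) {ω : Forms lam} (hω : ω ∈ kForms lam k) :
    d lam ω = lam⁻¹ • (ω * theta lam - (-1 : ℂ) ^ k • (theta lam * ω)) := by
  induction hω using Submodule.span_induction with
  | mem ω h =>
    obtain ⟨m, hm, f, rfl⟩ := h
    rw [d_form, dFun_eq, mul_smul_comm, mul_sub, mul_assoc]
    congr 2
    rw [theta, basicOneForm, ← mul_assoc, ← mul_assoc, ← map_mul, ι_mul_of_mem _ k hm, map_smul,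
      map_mul, smul_mul_assoc]
  | zero => simp
  | add a b _ _ ha hb =>
    rw [map_add, ha, hb, add_mul, mul_add, smul_add, ← smul_add]
    congr 1
    abel
  | smul c a _ ha =>
    rw [map_smul, ha, smul_mul_assoc, mul_smul_comm, smul_comm _ c, ← smul_sub, smul_comm c]

lemma d_mem (k : ℕ) {ω : Forms lam} (hω : ω ∈ kForms lam k) : d lam ω ∈ kForms lam (k + 1) := by
  induction hω using Submodule.span_induction with
  | mem ω h =>
    obtain ⟨m, hm, f, rfl⟩ := h
    rw [d_form, dFun_apply, mul_smul_comm]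
    refine Submodule.smul_mem _ _ ?_
    generalize comul lam f = T
    induction T using TensorProduct.induction_on with
    | zero => simp
    | tmul a b =>
      refine Submodule.subset_span ⟨m * ExteriorAlgebra.ι ℂ
        (rho lam a - algebraMap ℂ M2 (counit lam a)), ?_, b, ?_⟩
      · rw [ExteriorAlgebra.exteriorPower, pow_succ]
        exact Submodule.mul_mem_mul hm ⟨_, rfl⟩
      · rw [map_mul, mul_assoc, ofBasic_mul_ofFun lam (ExteriorAlgebra.ι ℂ _)]
        simp
    | add a b ha hb => rw [map_add, mul_add]; exact Submodule.add_mem _ ha hb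
  | zero => simp
  | add a b _ _ ha hb => rw [map_add]; exact Submodule.add_mem _ ha hb
  | smul c a _ ha => rw [map_smul]; exact Submodule.smul_mem _ _ ha

lemma d_d_of_mem (k : ℕ) {ω : Forms lam} (hω : ω ∈ kForms lam k) : d lam (d lam ω) = 0 := by
  have h1 : ω * theta lam * theta lam = 0 := by rw [mul_assoc, theta_mul_theta, mul_zero]
  have h2 : theta lam * (theta lam * ω) = 0 := by rw [← mul_assoc, theta_mul_theta, zero_mul]
  rw [d_eq_of_mem lam (k + 1) (d_mem lam k hω), d_eq_of_mem lam k hω]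
  simp only [smul_mul_assoc, mul_smul_comm, sub_mul, mul_sub, h1, h2, pow_succ, mul_assoc,
    smul_zero, sub_zero, zero_sub, mul_neg, mul_one, neg_smul, smul_neg, smul_comm _ lam⁻¹,
    sub_neg_eq_add, neg_add_cancel]

lemma der_mem (A : M2) (k : ℕ) {m : Lam} (hm : m ∈ ⋀[ℂ]^k M2) : der A m ∈ ⋀[ℂ]^k M2 := by
  induction k generalizing m with
  | zero =>
    rw [ExteriorAlgebra.exteriorPower, pow_zero] at hm ⊢
    obtain ⟨c, rfl⟩ := Submodule.mem_one.mp hm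
    simp [Algebra.algebraMap_eq_smul_one]
  | succ k ih =>
    rw [ExteriorAlgebra.exteriorPower, pow_succ] at hm ⊢
    induction hm using Submodule.mul_induction_on' with
    | mem_mul_mem u hu w hw =>
      obtain ⟨w, rfl⟩ := hw
      rw [der_mul, der_ι]
      exact Submodule.add_mem _ (Submodule.mul_mem_mul (ih hu) ⟨_, rfl⟩)
        (Submodule.mul_mem_mul hu ⟨_, rfl⟩)
    | add a _ b _ ha hb => rw [map_add]; exact Submodule.add_mem _ ha hb

lemma leftMul_mem (f : R3 lam) (k : ℕ) {ω : Forms lam} (hω : ω ∈ kForms lam k) :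
    leftMul lam f ω ∈ kForms lam k := by
  induction f using R3_induction generalizing ω with
  | one => simpa using hω
  | gen a =>
    induction hω using Submodule.span_induction with
    | mem ω h =>
      obtain ⟨m, hm, g, rfl⟩ := h
      rw [ofBasic_mul_ofFun, leftMul_x, ← ofBasic_mul_ofFun, ← ofBasic_mul_ofFun]
      exact Submodule.add_mem _ (Submodule.subset_span ⟨_, der_mem _ k hm, _, rfl⟩)
        (Submodule.subset_span ⟨_, hm, _, rfl⟩)
    | zero => simp
    | add a b _ _ ha hb => rw [map_add]; exact Submodule.add_mem _ ha hb
    | smul c a _ ha => rw [map_smul]; exact Submodule.smul_mem _ _ ha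
  | smul c f hf => rw [map_smul]; exact Submodule.smul_mem _ _ (hf hω)
  | add f g hf hg => rw [map_add]; exact Submodule.add_mem _ (hf hω) (hg hω)
  | mul f g hf hg => rw [map_mul]; exact hf (hg hω)

lemma mul_mem_kForms (j k : ℕ) {ω η : Forms lam} (hω : ω ∈ kForms lam j) (hη : η ∈ kForms lam k) :
    ω * η ∈ kForms lam (j + k) := by
  induction hω using Submodule.span_induction with
  | mem ω h =>
    obtain ⟨m, hm, f, rfl⟩ := h
    rw [ofBasic_mul_ofFun, mul_def, mulMap_form]
    have h := leftMul_mem lam f k hη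
    generalize leftMul lam f η = ζ at h
    induction h using Submodule.span_induction with
    | mem ζ h =>
      obtain ⟨n, hn, g, rfl⟩ := h
      rw [ofBasic_mul_ofFun, wedgeLeft_form, ← ofBasic_mul_ofFun]
      refine Submodule.subset_span ⟨_, ?_, _, rfl⟩
      rw [ExteriorAlgebra.exteriorPower, pow_add]
      exact Submodule.mul_mem_mul hm hn
    | zero => simp
    | add a b _ _ ha hb => rw [map_add]; exact Submodule.add_mem _ ha hb
    | smul c a _ ha => rw [map_smul]; exact Submodule.smul_mem _ _ ha
  | zero => simp
  | add a b _ _ ha hb => rw [add_mul]; exact Submodule.add_mem _ ha hb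
  | smul c a _ ha => rw [smul_mul_assoc]; exact Submodule.smul_mem _ _ ha

/-- The graded Leibniz rule `d (ω η) = ω dη + (-1)^{deg η} (dω) η`. -/
lemma d_mul (j k : ℕ) {ω η : Forms lam} (hω : ω ∈ kForms lam j) (hη : η ∈ kForms lam k) :
    d lam (ω * η) = ω * d lam η + (-1 : ℂ) ^ k • (d lam ω * η) := by
  rw [d_eq_of_mem lam _ (mul_mem_kForms lam j k hω hη), d_eq_of_mem lam _ hω, d_eq_of_mem lam _ hη]
  simp only [smul_mul_assoc, mul_smul_comm, smul_comm _ lam⁻¹, ← smul_add]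
  congr 1
  simp only [mul_sub, sub_mul, smul_sub, smul_mul_assoc, mul_smul_comm, smul_smul, mul_assoc,
    pow_add, mul_comm ((-1 : ℂ) ^ k)]
  abel

/-! ### The de Rham cohomology -/

/-- The closed `k`-forms. -/
def closedForms (k : ℕ) : Submodule ℂ (Forms lam) := kForms lam k ⊓ LinearMap.ker (d lam)

/-- The exact `k`-forms; in degree `0` only the form `0` is exact. -/
def exactForms : ℕ → Submodule ℂ (Forms lam)
  | 0 => ⊥
  | k + 1 => (kForms lam k).map (d lam)

lemma exactForms_le_closedForms (k : ℕ) : exactForms lam k ≤ closedForms lam k := by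
  cases k with
  | zero => exact bot_le
  | succ k =>
    rintro _ ⟨ω, hω, rfl⟩
    exact ⟨d_mem lam k hω, d_d_of_mem lam k hω⟩

/-- The de Rham cohomology `H^k`: closed `k`-forms modulo exact `k`-forms. -/
abbrev deRham (k : ℕ) : Type :=
  closedForms lam k ⧸ (exactForms lam k).submoduleOf (closedForms lam k)

/-- The cohomology class of a closed form. -/
def deRhamClass {k : ℕ} (ω : Forms lam) (hω : ω ∈ closedForms lam k) : deRham lam k :=
  Submodule.Quotient.mk ⟨ω, hω⟩

lemma one_mem_closedForms : (1 : Forms lam) ∈ closedForms lam 0 := by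
  have h : (1 : Forms lam) ∈ kForms lam 0 :=
    Submodule.subset_span ⟨1, by simp [Submodule.mem_one], 1, by simp⟩
  exact ⟨h, by change d lam _ = 0; rw [d_eq_of_mem lam 0 h]; simp⟩

lemma theta_mem_closedForms : theta lam ∈ closedForms lam 1 := by
  have h : theta lam ∈ kForms lam 1 :=
    Submodule.subset_span ⟨ExteriorAlgebra.ι ℂ 1, by simp, 1, by simp [theta, basicOneForm]⟩
  exact ⟨h, by change d lam _ = 0; rw [d_eq_of_mem lam 1 h, theta_mul_theta]; simp⟩

end QuantumR3

end

noncomputable section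

namespace QuantumR3

/-! ### The degree filtration of the coordinate algebra -/

/-! The proof is a Poincaré lemma with the Euler vector field, carried out modulo terms of lower
degree in the `x_a`. Contraction with `∑ x_a ∂_a` gives an operator `homotopy` lowering form degree
by one. Classically its anticommutator with `d` multiplies a form by coefficient degree plus form
degree. Here the generators commute and the Leibniz rule holds only up to lower degree, and the
extra direction `θ` has no coordinate. So, on `k`-forms with coefficients of degree at most `n`, the
anticommutator is `(n + k) - P` modulo lower degree, where the idempotent `P` (`thetaProj`,
`thetaPart`) picks out the part containing `θ` (`homotopy_d_add_d_homotopy_sub_mem`).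

On a closed form the anticommutator reduces to `d ∘ homotopy`. The eigenvalues of `(n + k) - P` lie
among `n + k` and `n + k - 1`, so for `k ≥ 1` it is invertible unless `n + k = 1`, and a quadratic
polynomial in it gives the inverse. A closed form is then exact up to lower coefficient degree
(`exists_sub_d_mem_formFilt`), and descent finishes: in degree at least 2 nothing is left, while in
degree 1 the constant-coefficient forms remain, spanned by the exact `d x_a` and `θ`.

On functions, `homotopy ∘ d` is `euler`, which is `n` on leading terms, so its kernel consists of
constants. Since `homotopy` kills `θ`, a primitive of `θ` would be constant, hence `θ = 0`, which is
false. Only an increasing filtration is used; no basis of `ℝ³_λ` is needed. -/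

/-- The degree filtration of `ℝ³_λ`, shifted by one: `filt (n + 1)` is spanned by the products of
at most `n` generators, and `filt 0 = 0`. -/
def filt (lam : ℂ) : ℕ → Submodule ℂ (R3 lam)
  | 0 => ⊥
  | n + 1 => Submodule.span ℂ ({1} ∪ {f | ∃ a, ∃ g ∈ filt lam n, f = x lam a * g})

variable (lam : ℂ)

lemma one_mem_filt (n : ℕ) : (1 : R3 lam) ∈ filt lam (n + 1) :=
  Submodule.subset_span (Or.inl rfl)

variable {lam} in
lemma x_mul_mem_filt (a : Fin 3) {n : ℕ} {f : R3 lam} (hf : f ∈ filt lam n) :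
    x lam a * f ∈ filt lam (n + 1) :=
  Submodule.subset_span (Or.inr ⟨a, f, hf, rfl⟩)

lemma filt_succ_le {n : ℕ} {p : Submodule ℂ (R3 lam)} (one : 1 ∈ p)
    (mul : ∀ a, ∀ f ∈ filt lam n, x lam a * f ∈ p) : filt lam (n + 1) ≤ p := by
  refine Submodule.span_le.mpr ?_
  rintro f (rfl | ⟨a, g, hg, rfl⟩)
  · exact one
  · exact mul a g hg

lemma filt_le_succ (n : ℕ) : filt lam n ≤ filt lam (n + 1) := by
  induction n with
  | zero => exact bot_le
  | succ n ih =>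
    exact filt_succ_le lam (one_mem_filt lam _) fun a f hf => x_mul_mem_filt a (ih hf)

lemma filt_mono : Monotone (filt lam) := monotone_nat_of_le_succ (filt_le_succ lam)

lemma exists_mem_filt (f : R3 lam) : ∃ n, f ∈ filt lam n := by
  -- Only left multiplication by generators is controlled by `filt`, so the induction on `f` must
  -- carry an arbitrary right factor.
  have key : ∀ g : R3 lam, ∀ n, g ∈ filt lam n → ∃ m, f * g ∈ filt lam m := by
    induction f using R3_induction with
    | one => exact fun g n hg => ⟨n, by simpa using hg⟩
    | gen a => exact fun g n hg => ⟨n + 1, x_mul_mem_filt a hg⟩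
    | smul c f hf =>
      intro g n hg
      obtain ⟨m, hm⟩ := hf g n hg
      exact ⟨m, by rw [smul_mul_assoc]; exact Submodule.smul_mem _ _ hm⟩
    | add f f' hf hf' =>
      intro g n hg
      obtain ⟨m, hm⟩ := hf g n hg
      obtain ⟨m', hm'⟩ := hf' g n hg
      refine ⟨max m m', ?_⟩
      rw [add_mul]
      exact Submodule.add_mem _ (filt_mono lam (le_max_left _ _) hm)
        (filt_mono lam (le_max_right _ _) hm')
    | mul f f' hf hf' =>
      intro g n hg
      obtain ⟨m, hm⟩ := hf' g n hg
      rw [mul_assoc]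
      exact hf _ m hm
  obtain ⟨m, hm⟩ := key 1 1 (one_mem_filt lam 0)
  exact ⟨m, by simpa using hm⟩

variable {lam} in
lemma mem_filt_one {f : R3 lam} (hf : f ∈ filt lam 1) : ∃ c : ℂ, f = c • (1 : R3 lam) := by
  have h : filt lam 1 ≤ ℂ ∙ (1 : R3 lam) := by
    refine filt_succ_le lam (Submodule.mem_span_singleton_self _) fun a g hg => ?_
    rw [(Submodule.mem_bot ℂ).mp hg, mul_zero]
    exact Submodule.zero_mem _
  obtain ⟨c, hc⟩ := Submodule.mem_span_singleton.mp (h hf)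
  exact ⟨c, hc.symm⟩

-- Commutators of generators are linear in the generators, so two factors become one: left
-- multiplications by generators commute up to lower degree.
variable {lam} in
lemma x_mul_x_sub_mem_filt (a b : Fin 3) {n : ℕ} {f : R3 lam} (hf : f ∈ filt lam n) :
    x lam a * (x lam b * f) - x lam b * (x lam a * f) ∈ filt lam (n + 1) := by
  have key : ∀ a, x lam a * (x lam (a + 1) * f) - x lam (a + 1) * (x lam a * f)
      ∈ filt lam (n + 1) := by
    intro a
    rw [← mul_assoc, x_comm, add_mul, mul_assoc, add_sub_cancel_left, smul_mul_assoc]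
    exact Submodule.smul_mem _ _ (x_mul_mem_filt _ hf)
  -- The relations are indexed by cyclic pairs only; the remaining pairs follow by antisymmetry.
  have hab : b = a ∨ b = a + 1 ∨ a = b + 1 := by decide +revert
  rcases hab with rfl | rfl | rfl
  · simp
  · exact key a
  · rw [← neg_sub]
    exact Submodule.neg_mem _ (key b)

/-! ### The derivative with values in `M₂(ℂ) ⊗ ℝ³_λ` -/

/-- The algebra map `f ↦ ρ(f₁) ⊗ f₂`. -/
def coact : R3 lam →ₐ[ℂ] M2 ⊗[ℂ] R3 lam :=
  (Algebra.TensorProduct.map (rho lam) (AlgHom.id ℂ (R3 lam))).comp (comul lam)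

lemma coact_x (a : Fin 3) :
    coact lam (x lam a) = rho lam (x lam a) ⊗ₜ 1 + 1 ⊗ₜ x lam a := by
  simp [coact, comul_x]

/-- The derivative of functions with values in `M₂(ℂ) ⊗ ℝ³_λ`. -/
def grad : R3 lam →ₗ[ℂ] M2 ⊗[ℂ] R3 lam :=
  lam⁻¹ • ((coact lam).toLinearMap - TensorProduct.mk ℂ M2 (R3 lam) 1)

lemma grad_apply (f : R3 lam) : grad lam f = lam⁻¹ • (coact lam f - 1 ⊗ₜ f) := rfl

lemma grad_one : grad lam 1 = 0 := by
  rw [grad_apply, map_one, Algebra.TensorProduct.one_def, sub_self, smul_zero]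

-- A deformed Leibniz rule, coming from multiplicativity of `coact`. The middle term is the
-- noncommutative correction; its coefficients have lower degree than those of the other two.
variable {lam} in
lemma grad_x_mul (hlam : lam ≠ 0) (a : Fin 3) (f : R3 lam) :
    grad lam (x lam a * f) = (1 ⊗ₜ x lam a) * grad lam f
      + (((lam / 2) • pauli a) ⊗ₜ 1 * grad lam f + ((1 / 2 : ℂ) • pauli a) ⊗ₜ f) := by
  have hc : lam⁻¹ * (lam / 2) = 1 / 2 := by field_simp
  have h : ((1 / 2 : ℂ) • pauli a) ⊗ₜ[ℂ] f
      = lam⁻¹ • ((((lam / 2) • pauli a) ⊗ₜ[ℂ] (1 : R3 lam)) * ((1 : M2) ⊗ₜ[ℂ] f)) := by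
    rw [Algebra.TensorProduct.tmul_mul_tmul, mul_one, one_mul, TensorProduct.smul_tmul',
      smul_smul, hc]
  have h' : (1 : M2) ⊗ₜ[ℂ] (x lam a * f) = (1 ⊗ₜ x lam a) * (1 ⊗ₜ f) := by
    rw [Algebra.TensorProduct.tmul_mul_tmul, mul_one]
  rw [h, grad_apply, grad_apply, map_mul, coact_x, rho_x, h', mul_smul_comm, mul_smul_comm,
    ← smul_add, ← smul_add]
  congr 1
  rw [add_mul, mul_sub, mul_sub]
  abel

/-- The filtration of `M₂(ℂ) ⊗ ℝ³_λ` by the degree of the second factor. -/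
def matFilt (n : ℕ) : Submodule ℂ (M2 ⊗[ℂ] R3 lam) :=
  Submodule.map₂ (TensorProduct.mk ℂ M2 (R3 lam)) ⊤ (filt lam n)

variable {lam}

lemma tmul_mem_matFilt (m : M2) {n : ℕ} {f : R3 lam} (hf : f ∈ filt lam n) :
    m ⊗ₜ f ∈ matFilt lam n :=
  Submodule.apply_mem_map₂ _ Submodule.mem_top hf

lemma map_mem_of_mem_matFilt {M : Type*} [AddCommGroup M] [Module ℂ M] {n : ℕ}
    {p : Submodule ℂ M} (F : M2 ⊗[ℂ] R3 lam →ₗ[ℂ] M)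
    (h : ∀ m, ∀ f ∈ filt lam n, F (m ⊗ₜ f) ∈ p) {t : M2 ⊗[ℂ] R3 lam} (ht : t ∈ matFilt lam n) :
    F t ∈ p := by
  have : matFilt lam n ≤ p.comap F := Submodule.map₂_le.mpr fun m _ f hf => h m f hf
  exact this ht

lemma matFilt_le_succ (n : ℕ) : matFilt lam n ≤ matFilt lam (n + 1) :=
  Submodule.map₂_le_map₂_right (filt_le_succ lam n)

lemma tmul_one_mul_mem_matFilt (A : M2) {n : ℕ} {t : M2 ⊗[ℂ] R3 lam} (ht : t ∈ matFilt lam n) :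
    A ⊗ₜ 1 * t ∈ matFilt lam n := by
  refine map_mem_of_mem_matFilt (LinearMap.mulLeft ℂ (A ⊗ₜ[ℂ] (1 : R3 lam))) (fun m f hf => ?_) ht
  rw [LinearMap.mulLeft_apply, Algebra.TensorProduct.tmul_mul_tmul, one_mul]
  exact tmul_mem_matFilt _ hf

lemma one_tmul_x_mul_mem_matFilt (a : Fin 3) {n : ℕ} {t : M2 ⊗[ℂ] R3 lam}
    (ht : t ∈ matFilt lam n) : 1 ⊗ₜ x lam a * t ∈ matFilt lam (n + 1) := by
  refine map_mem_of_mem_matFilt (LinearMap.mulLeft ℂ ((1 : M2) ⊗ₜ[ℂ] x lam a))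
    (fun m f hf => ?_) ht
  rw [LinearMap.mulLeft_apply, Algebra.TensorProduct.tmul_mul_tmul]
  exact tmul_mem_matFilt _ (x_mul_mem_filt a hf)

lemma grad_mem_matFilt (hlam : lam ≠ 0) (n : ℕ) {f : R3 lam} (hf : f ∈ filt lam (n + 1)) :
    grad lam f ∈ matFilt lam n := by
  suffices h : filt lam (n + 1) ≤ (matFilt lam n).comap (grad lam) from h hf
  clear hf f
  induction n with
  | zero =>
    refine filt_succ_le lam ?_ fun a f hf => ?_
    · simp [grad_one]
    · simp [(Submodule.mem_bot ℂ).mp hf]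
  | succ n ih =>
    refine filt_succ_le lam ?_ fun a f hf => ?_
    · simp [grad_one]
    · rw [Submodule.mem_comap, grad_x_mul hlam]
      refine Submodule.add_mem _ (one_tmul_x_mul_mem_matFilt a (ih hf)) (Submodule.add_mem _ ?_ ?_)
      · exact matFilt_le_succ n (tmul_one_mul_mem_matFilt _ (ih hf))
      · exact tmul_mem_matFilt _ hf

/-! ### The Euler operator -/

/-- The linear functionals on `M₂(ℂ)` dual to the basis `σ_a / 2`, `θ`, for `σ_a / 2`. -/
def pauliDual (a : Fin 3) : Module.Dual ℂ M2 :=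
  Matrix.traceLinearMap (Fin 2) ℂ ℂ ∘ₗ LinearMap.mulLeft ℂ (pauli a)

/-- The linear functional on `M₂(ℂ)` dual to `θ` in the basis `σ_a / 2`, `θ`. -/
def thetaDual : Module.Dual ℂ M2 := (1 / 2 : ℂ) • Matrix.traceLinearMap (Fin 2) ℂ ℂ

lemma pauliDual_pauli (a b : Fin 3) :
    pauliDual a ((1 / 2 : ℂ) • pauli b) = if a = b then 1 else 0 := by
  fin_cases a <;> fin_cases b <;>
    simp [pauliDual, pauli, Matrix.trace, Fin.sum_univ_two] <;> ring_nf <;> simp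

lemma pauliDual_one (a : Fin 3) : pauliDual a 1 = 0 := by
  fin_cases a <;> simp [pauliDual, pauli, Matrix.trace, Fin.sum_univ_two]

lemma thetaDual_one : thetaDual 1 = 1 := by
  simp [thetaDual]

lemma sum_pauliDual_smul (m : M2) :
    ∑ a, pauliDual a m • ((1 / 2 : ℂ) • pauli a) = m - thetaDual m • 1 := by
  ext i j
  fin_cases i <;> fin_cases j <;>
    simp [pauliDual, thetaDual, pauli, Matrix.trace, Matrix.mul_apply, Matrix.sum_apply,
      Fin.sum_univ_two, Fin.sum_univ_three] <;> ring_nf <;> (try simp) <;> (try ring)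

/-- Evaluation of a functional on the first factor of `M₂(ℂ) ⊗ ℝ³_λ`. -/
def slice (φ : Module.Dual ℂ M2) : M2 ⊗[ℂ] R3 lam →ₗ[ℂ] R3 lam :=
  TensorProduct.lift ((LinearMap.lsmul ℂ (R3 lam)).comp φ)

@[simp]
lemma slice_tmul (φ : Module.Dual ℂ M2) (m : M2) (f : R3 lam) : slice φ (m ⊗ₜ f) = φ m • f := rfl

lemma slice_mem_filt (φ : Module.Dual ℂ M2) {n : ℕ} {t : M2 ⊗[ℂ] R3 lam}
    (ht : t ∈ matFilt lam n) : slice φ t ∈ filt lam n :=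
  map_mem_of_mem_matFilt _ (fun _ _ hf => Submodule.smul_mem _ _ hf) ht

lemma slice_one_tmul_mul (φ : Module.Dual ℂ M2) (g : R3 lam) (t : M2 ⊗[ℂ] R3 lam) :
    slice φ (1 ⊗ₜ g * t) = g * slice φ t := by
  induction t using TensorProduct.induction_on with
  | zero => simp
  | tmul m f => simp
  | add s t hs ht => rw [mul_add, map_add, map_add, hs, ht, mul_add]

/-- The operator `f ↦ ∑ x_a ∂_a f`. -/
def euler (f : R3 lam) : R3 lam := ∑ a, x lam a * slice (pauliDual a) (grad lam f)

/-- Euler's identity for homogeneous polynomials survives on leading terms. Because of the shift,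
`filt lam (n + 1)` means degree at most `n`, whence the eigenvalue `n`. -/
lemma euler_sub_mem_filt (hlam : lam ≠ 0) (n : ℕ) {f : R3 lam} (hf : f ∈ filt lam (n + 1)) :
    euler f - (n : ℂ) • f ∈ filt lam n := by
  -- Packaged as a linear map, so that the claim is an inclusion into a `comap` and can be tested on
  -- spanning elements.
  let D : R3 lam →ₗ[ℂ] R3 lam :=
    ∑ a, LinearMap.mulLeft ℂ (x lam a) ∘ₗ slice (pauliDual a) ∘ₗ grad lam
  have hD : ∀ f : R3 lam, D f = euler f := fun f => by simp [D, euler]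
  suffices h : ∀ n : ℕ, filt lam (n + 1) ≤ (filt lam n).comap (D - (n : ℂ) • LinearMap.id) by
    simpa [hD] using h n hf
  clear hf f n
  intro n
  induction n with
  | zero =>
    refine filt_succ_le lam ?_ fun a f hf => ?_
    · simp [hD, euler, grad_one]
    · simp [(Submodule.mem_bot ℂ).mp hf]
  | succ n ih =>
    refine filt_succ_le lam ?_ fun b f hf => ?_
    · rw [Submodule.mem_comap]
      simp only [LinearMap.sub_apply, hD, LinearMap.smul_apply, LinearMap.id_apply, euler,
        grad_one, map_zero, mul_zero, Finset.sum_const_zero, zero_sub]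
      exact Submodule.neg_mem _ (Submodule.smul_mem _ _ (one_mem_filt lam n))
    · have hg := grad_mem_matFilt hlam n hf
      have hih : euler f - (n : ℂ) • f ∈ filt lam n := by simpa [hD] using ih hf
      have hsum : ∑ a, x lam a * slice (pauliDual a) (((1 / 2 : ℂ) • pauli b) ⊗ₜ[ℂ] f)
          = x lam b * f := by
        simp only [slice_tmul, pauliDual_pauli]
        simp
      -- Three errors, each of lower degree: the induction hypothesis times `x_b`, commutators of
      -- generators, and the Leibniz correction.
      have key : euler (x lam b * f) - ((n + 1 : ℕ) : ℂ) • (x lam b * f)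
          = x lam b * (euler f - (n : ℂ) • f)
            + ∑ a, (x lam a * (x lam b * slice (pauliDual a) (grad lam f))
              - x lam b * (x lam a * slice (pauliDual a) (grad lam f)))
            + ∑ a, x lam a * slice (pauliDual a) (((lam / 2) • pauli b) ⊗ₜ 1 * grad lam f) := by
        simp only [euler, grad_x_mul hlam, map_add, slice_one_tmul_mul, mul_add,
          Finset.sum_add_distrib, hsum, Finset.sum_sub_distrib, mul_sub, Finset.mul_sum,
          mul_smul_comm]
        push_cast
        rw [add_smul, one_smul]
        abel
      rw [Submodule.mem_comap]
      simp only [LinearMap.sub_apply, hD, LinearMap.smul_apply, LinearMap.id_apply]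
      rw [key]
      refine Submodule.add_mem _ (Submodule.add_mem _ (x_mul_mem_filt b hih) ?_) ?_
      · exact Submodule.sum_mem _ fun a _ => x_mul_x_sub_mem_filt a b (slice_mem_filt _ hg)
      · exact Submodule.sum_mem _ fun a _ =>
          x_mul_mem_filt a (slice_mem_filt _ (tmul_one_mul_mem_matFilt _ hg))

/-- In positive degree `n` the eigenvalue is nonzero, so vanishing of `euler f` forces `f` down one
filtration step, until only constants remain. -/
lemma exists_eq_smul_one_of_euler_eq_zero (hlam : lam ≠ 0) {f : R3 lam} (hf : euler f = 0) :
    ∃ c : ℂ, f = c • (1 : R3 lam) := by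
  obtain ⟨n, hn⟩ := exists_mem_filt lam f
  suffices h : ∀ n, f ∈ filt lam (n + 1) → f ∈ filt lam 1 from
    mem_filt_one (h n (filt_le_succ lam n hn))
  clear hn n
  intro n
  induction n with
  | zero => exact id
  | succ n ih =>
    intro h
    refine ih ?_
    have hn := euler_sub_mem_filt hlam (n + 1) h
    rw [hf, zero_sub, Submodule.neg_mem_iff] at hn
    exact (Submodule.smul_mem_iff _ (Nat.cast_ne_zero.mpr n.succ_ne_zero)).mp hn

/-! ### Contractions on the exterior algebra -/

/-- The contraction of an element of the exterior algebra with a functional, from the right. -/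
def contr (φ : Module.Dual ℂ M2) : Lam →ₗ[ℂ] Lam :=
  (CliffordAlgebra.contractRight (Q := (0 : QuadraticForm ℂ M2))).flip φ

/-- Contracting from the right matches the convention `d (m f) = m ∧ d f`, so no sign depending on
the degree of `u` enters. -/
lemma contr_mul_ι (φ : Module.Dual ℂ M2) (u : Lam) (v : M2) :
    contr φ (u * ExteriorAlgebra.ι ℂ v) = φ v • u - contr φ u * ExteriorAlgebra.ι ℂ v :=
  CliffordAlgebra.contractRight_mul_ι _ _ _

lemma contr_contr (φ : Module.Dual ℂ M2) (u : Lam) : contr φ (contr φ u) = 0 :=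
  CliffordAlgebra.contractRight_contractRight _ _

lemma contr_of_mem_zero (φ : Module.Dual ℂ M2) {u : Lam} (hu : u ∈ ⋀[ℂ]^0 M2) :
    contr φ u = 0 := by
  rw [ExteriorAlgebra.exteriorPower, pow_zero] at hu
  obtain ⟨c, rfl⟩ := Submodule.mem_one.mp hu
  exact CliffordAlgebra.contractRight_algebraMap _ _ c

lemma contr_one (φ : Module.Dual ℂ M2) : contr φ 1 = 0 :=
  CliffordAlgebra.contractRight_one _ _

lemma mul_ι_mem (v : M2) {k : ℕ} {u : Lam} (hu : u ∈ ⋀[ℂ]^k M2) :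
    u * ExteriorAlgebra.ι ℂ v ∈ ⋀[ℂ]^(k + 1) M2 := by
  rw [ExteriorAlgebra.exteriorPower, pow_succ]
  exact Submodule.mul_mem_mul hu ⟨v, rfl⟩

/-- Induction on the degree of homogeneous elements of the exterior algebra. -/
lemma exteriorPower_succ_induction {k : ℕ} {P : Lam → Prop}
    (mul : ∀ u ∈ ⋀[ℂ]^k M2, ∀ v, P (u * ExteriorAlgebra.ι ℂ v))
    (add : ∀ u v, P u → P v → P (u + v)) {u : Lam} (hu : u ∈ ⋀[ℂ]^(k + 1) M2) : P u := by
  rw [ExteriorAlgebra.exteriorPower, pow_succ] at hu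
  induction hu using Submodule.mul_induction_on' with
  | mem_mul_mem u hu w hw =>
    obtain ⟨w, rfl⟩ := hw
    exact mul u hu w
  | add a _ b _ ha hb => exact add a b ha hb

lemma contr_mem (φ : Module.Dual ℂ M2) (k : ℕ) {u : Lam} (hu : u ∈ ⋀[ℂ]^(k + 1) M2) :
    contr φ u ∈ ⋀[ℂ]^k M2 := by
  induction k generalizing u with
  | zero =>
    refine exteriorPower_succ_induction (P := fun u => contr φ u ∈ ⋀[ℂ]^0 M2) (fun u hu v => ?_)
      (fun u v hu hv => by rw [map_add]; exact Submodule.add_mem _ hu hv) hu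
    rw [contr_mul_ι, contr_of_mem_zero φ hu, zero_mul, sub_zero]
    exact Submodule.smul_mem _ _ hu
  | succ k ih =>
    refine exteriorPower_succ_induction (P := fun u => contr φ u ∈ ⋀[ℂ]^(k + 1) M2)
      (fun u hu v => ?_)
      (fun u v hu hv => by rw [map_add]; exact Submodule.add_mem _ hu hv) hu
    rw [contr_mul_ι]
    exact Submodule.sub_mem _ (Submodule.smul_mem _ _ hu) (mul_ι_mem v (ih hu))

lemma contr_mul_ι_mem (φ : Module.Dual ℂ M2) (v : M2) (k : ℕ) {u : Lam} (hu : u ∈ ⋀[ℂ]^k M2) :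
    contr φ u * ExteriorAlgebra.ι ℂ v ∈ ⋀[ℂ]^k M2 := by
  cases k with
  | zero => simp [contr_of_mem_zero φ hu]
  | succ k => exact mul_ι_mem v (contr_mem φ k hu)

/-- The derivation of the exterior algebra extending the projection of `M₂(ℂ)` on `ℂ θ`. -/
def thetaProj : Lam →ₗ[ℂ] Lam :=
  LinearMap.mulRight ℂ (ExteriorAlgebra.ι ℂ 1) ∘ₗ contr thetaDual

lemma thetaProj_apply (u : Lam) :
    thetaProj u = contr thetaDual u * ExteriorAlgebra.ι ℂ 1 := rfl

lemma thetaProj_thetaProj (u : Lam) : thetaProj (thetaProj u) = thetaProj u := by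
  rw [thetaProj_apply, thetaProj_apply, contr_mul_ι, contr_contr, thetaDual_one, one_smul,
    zero_mul, sub_zero]

/-- Contracting and re-multiplying over a full dual basis counts form degree; omitting the `θ`
direction subtracts `thetaProj`. -/
lemma sum_contr_pauliDual_mul (k : ℕ) {u : Lam} (hu : u ∈ ⋀[ℂ]^k M2) :
    ∑ a, contr (pauliDual a) u * ExteriorAlgebra.ι ℂ ((1 / 2 : ℂ) • pauli a)
      = (k : ℂ) • u - thetaProj u := by
  induction k generalizing u with
  | zero => simp [contr_of_mem_zero _ hu, thetaProj_apply]
  | succ k ih =>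
    refine exteriorPower_succ_induction (P := fun u =>
      ∑ a, contr (pauliDual a) u * ExteriorAlgebra.ι ℂ ((1 / 2 : ℂ) • pauli a)
        = ((k + 1 : ℕ) : ℂ) • u - thetaProj u) (fun u hu v => ?_) (fun u v hu hv => ?_) hu
    · have swap : ∀ w : M2, ∀ z : Lam, z * ExteriorAlgebra.ι ℂ v * ExteriorAlgebra.ι ℂ w
          = -(z * ExteriorAlgebra.ι ℂ w * ExteriorAlgebra.ι ℂ v) := by
        intro w z
        rw [mul_assoc, eq_neg_of_add_eq_zero_left (ExteriorAlgebra.ι_add_mul_swap (R := ℂ) v w),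
          mul_neg, mul_assoc]
      simp only [contr_mul_ι, sub_mul, swap, sub_neg_eq_add, Finset.sum_add_distrib,
        thetaProj_apply, ← Finset.sum_mul, ih hu]
      have h : ∑ a, (pauliDual a v • u) * ExteriorAlgebra.ι ℂ ((1 / 2 : ℂ) • pauli a)
          = u * ExteriorAlgebra.ι ℂ v - (thetaDual v • u) * ExteriorAlgebra.ι ℂ 1 := by
        simp only [smul_mul_assoc, ← mul_smul_comm, ← map_smul, ← Finset.mul_sum, ← map_sum,
          sum_pauliDual_smul, map_sub, mul_sub]
      rw [h]
      push_cast
      rw [add_smul, one_smul, smul_mul_assoc (k : ℂ)]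
      abel
    · simp only [map_add, add_mul, Finset.sum_add_distrib, hu, hv, smul_add]
      abel

/-! ### The homotopy operator -/

/-- The map `M₂(ℂ) ⊗ ℝ³_λ → Ω¹`. -/
def oneForm : M2 ⊗[ℂ] R3 lam →ₗ[ℂ] Forms lam :=
  TensorProduct.lift ((form lam).comp (ExteriorAlgebra.ι ℂ))

@[simp]
lemma oneForm_tmul (m : M2) (f : R3 lam) :
    oneForm (m ⊗ₜ f) = form lam (ExteriorAlgebra.ι ℂ m) f := rfl

/-- The counit axiom collapses the `ε` part of the coproduct formula to `1 ⊗ f`. -/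
lemma dFun_eq_oneForm_grad (f : R3 lam) : dFun lam f = oneForm (grad lam f) := by
  have h : ∀ t : R3 lam ⊗[ℂ] R3 lam,
      TensorProduct.lift ((form lam).comp (ExteriorAlgebra.ι ℂ ∘ₗ
        ((rho lam).toLinearMap - Algebra.linearMap ℂ M2 ∘ₗ (counit lam).toLinearMap))) t
      = oneForm (Algebra.TensorProduct.map (rho lam) (AlgHom.id ℂ (R3 lam)) t
        - 1 ⊗ₜ Algebra.TensorProduct.lid ℂ (R3 lam)
          (Algebra.TensorProduct.map (counit lam) (AlgHom.id ℂ (R3 lam)) t)) := by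
    intro t
    induction t using TensorProduct.induction_on with
    | zero => simp
    | tmul a b => simp [Algebra.algebraMap_eq_smul_one]
    | add s t hs ht =>
      simp only [map_add, hs, ht, TensorProduct.tmul_add, map_sub]
      abel
  rw [dFun_apply, h, counit_comul, grad_apply, map_smul]
  rfl

lemma d_form_eq (m : Lam) (f : R3 lam) :
    d lam (form lam m f) = wedgeLeft lam m (oneForm (grad lam f)) := by
  rw [← ofBasic_mul_ofFun, d_form, dFun_eq_oneForm_grad, mul_def]
  change mulMap lam (form lam m 1) _ = _
  rw [mulMap_form, map_one, Module.End.one_apply]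

/-- The operator `m f ↦ (S m) (T f)` on forms. -/
def formMap (S : Lam →ₗ[ℂ] Lam) (T : R3 lam →ₗ[ℂ] R3 lam) : Forms lam →ₗ[ℂ] Forms lam :=
  TensorProduct.lift ((form lam).compl₁₂ S T)

@[simp]
lemma formMap_form (S : Lam →ₗ[ℂ] Lam) (T : R3 lam →ₗ[ℂ] R3 lam) (m : Lam) (f : R3 lam) :
    formMap S T (form lam m f) = form lam (S m) (T f) := rfl

/-- The homotopy operator: contraction with the Euler vector field. -/
def homotopy : Forms lam →ₗ[ℂ] Forms lam :=
  ∑ a, formMap (contr (pauliDual a)) (LinearMap.mulLeft ℂ (x lam a))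

lemma homotopy_form (m : Lam) (f : R3 lam) :
    homotopy (form lam m f) = ∑ a, form lam (contr (pauliDual a) m) (x lam a * f) := by
  simp [homotopy]

lemma homotopy_wedgeLeft_oneForm (m : Lam) (t : M2 ⊗[ℂ] R3 lam) :
    homotopy (wedgeLeft lam m (oneForm t))
      = form lam m (∑ a, x lam a * slice (pauliDual a) t)
        - ∑ a, wedgeLeft lam (contr (pauliDual a) m) (oneForm (1 ⊗ₜ x lam a * t)) := by
  induction t using TensorProduct.induction_on with
  | zero => simp
  | tmul v f =>
    rw [oneForm_tmul, wedgeLeft_form, homotopy_form, map_sum, ← Finset.sum_sub_distrib]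
    refine Finset.sum_congr rfl fun a _ => ?_
    rw [contr_mul_ι, Algebra.TensorProduct.tmul_mul_tmul, one_mul, oneForm_tmul, wedgeLeft_form,
      slice_tmul, map_sub, LinearMap.sub_apply, map_smul, LinearMap.smul_apply, mul_smul_comm,
      map_smul]
  | add s t hs ht =>
    simp only [map_add, hs, ht, mul_add, Finset.sum_add_distrib]
    abel

/-- The anticommutator of the homotopy operator with the exterior derivative. -/
lemma homotopy_d_add_d_homotopy_form (hlam : lam ≠ 0) (k : ℕ) {m : Lam} (hm : m ∈ ⋀[ℂ]^k M2)
    (f : R3 lam) :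
    homotopy (d lam (form lam m f)) + d lam (homotopy (form lam m f))
      = form lam m (euler f) + (k : ℂ) • form lam m f - form lam (thetaProj m) f
        + ∑ a, wedgeLeft lam (contr (pauliDual a) m)
            (oneForm (((lam / 2) • pauli a) ⊗ₜ 1 * grad lam f)) := by
  have h : ∑ a, wedgeLeft lam (contr (pauliDual a) m)
      (oneForm (((1 / 2 : ℂ) • pauli a) ⊗ₜ[ℂ] f))
      = (k : ℂ) • form lam m f - form lam (thetaProj m) f := by
    simp only [oneForm_tmul, wedgeLeft_form]
    rw [← LinearMap.sum_apply, ← map_sum, sum_contr_pauliDual_mul k hm, map_sub, map_smul,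
      LinearMap.sub_apply, LinearMap.smul_apply]
  have h' : d lam (homotopy (form lam m f)) =
      ∑ a, wedgeLeft lam (contr (pauliDual a) m) (oneForm (grad lam (x lam a * f))) := by
    rw [homotopy_form]
    exact (map_sum (d lam) _ _).trans (Finset.sum_congr rfl fun a _ => d_form_eq _ _)
  rw [h', d_form_eq, homotopy_wedgeLeft_oneForm]
  -- The undeformed Leibniz term `(1 ⊗ x_a) * grad f` from `d ∘ homotopy` cancels the negative sum
  -- in `homotopy ∘ d`; the `σ_a / 2` term yields the degree count `h`.
  simp only [grad_x_mul hlam, map_add, Finset.sum_add_distrib, h]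
  rw [euler]
  abel

/-! ### The filtration of the space of forms -/

variable (lam) in
/-- The filtration of the space of `k`-forms by the degree of the coefficients. -/
def formFilt (k n : ℕ) : Submodule ℂ (Forms lam) :=
  Submodule.map₂ (form lam) (⋀[ℂ]^k M2) (filt lam n)

lemma form_mem_formFilt {k n : ℕ} {m : Lam} (hm : m ∈ ⋀[ℂ]^k M2) {f : R3 lam}
    (hf : f ∈ filt lam n) : form lam m f ∈ formFilt lam k n :=
  Submodule.apply_mem_map₂ _ hm hf

lemma map_mem_of_mem_formFilt {k n : ℕ} {p : Submodule ℂ (Forms lam)}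
    (F : Forms lam →ₗ[ℂ] Forms lam)
    (h : ∀ m ∈ ⋀[ℂ]^k M2, ∀ f ∈ filt lam n, F (form lam m f) ∈ p) {ω : Forms lam}
    (hω : ω ∈ formFilt lam k n) : F ω ∈ p := by
  have : formFilt lam k n ≤ p.comap F := Submodule.map₂_le.mpr h
  exact this hω

lemma formFilt_le_kForms (k n : ℕ) : formFilt lam k n ≤ kForms lam k :=
  Submodule.map₂_le.mpr fun m hm f _ =>
    Submodule.subset_span ⟨m, hm, f, (ofBasic_mul_ofFun lam m f).symm⟩

lemma exists_mem_formFilt (k : ℕ) {ω : Forms lam} (hω : ω ∈ kForms lam k) :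
    ∃ n, ω ∈ formFilt lam k n := by
  induction hω using Submodule.span_induction with
  | mem ω h =>
    obtain ⟨m, hm, f, rfl⟩ := h
    obtain ⟨n, hn⟩ := exists_mem_filt lam f
    exact ⟨n, by rw [ofBasic_mul_ofFun]; exact form_mem_formFilt hm hn⟩
  | zero => exact ⟨0, Submodule.zero_mem _⟩
  | add a b _ _ ha hb =>
    obtain ⟨n, hn⟩ := ha
    obtain ⟨n', hn'⟩ := hb
    have mono : Monotone (formFilt lam k) := fun i j hij =>
      Submodule.map₂_le_map₂_right (filt_mono lam hij)
    exact ⟨max n n', Submodule.add_mem _ (mono (le_max_left _ _) hn) (mono (le_max_right _ _) hn')⟩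
  | smul c a _ ha =>
    obtain ⟨n, hn⟩ := ha
    exact ⟨n, Submodule.smul_mem _ _ hn⟩

lemma homotopy_mem_kForms (k : ℕ) {ω : Forms lam} (hω : ω ∈ kForms lam (k + 1)) :
    homotopy ω ∈ kForms lam k := by
  obtain ⟨n, hn⟩ := exists_mem_formFilt _ hω
  refine map_mem_of_mem_formFilt homotopy (fun m hm f hf => ?_) hn
  rw [homotopy_form]
  exact Submodule.sum_mem _ fun a _ => formFilt_le_kForms k (n + 1)
    (form_mem_formFilt (contr_mem _ k hm) (x_mul_mem_filt a hf))

variable (lam) in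
/-- The operator `m f ↦ (thetaProj m) f` on forms. -/
def thetaPart : Forms lam →ₗ[ℂ] Forms lam := formMap thetaProj LinearMap.id

lemma thetaPart_thetaPart (ω : Forms lam) : thetaPart lam (thetaPart lam ω) = thetaPart lam ω := by
  induction ω using forms_induction with
  | zero => simp
  | form m f => simp [thetaPart, thetaProj_thetaProj]
  | add a b ha hb => rw [map_add, map_add, ha, hb]

lemma thetaPart_mem_formFilt {k n : ℕ} {ω : Forms lam} (hω : ω ∈ formFilt lam k n) :
    thetaPart lam ω ∈ formFilt lam k n :=
  map_mem_of_mem_formFilt (thetaPart lam)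
    (fun _ hm _ hf => form_mem_formFilt (contr_mul_ι_mem _ _ k hm) hf) hω

lemma homotopy_d_add_d_homotopy_sub_mem (hlam : lam ≠ 0) (k n : ℕ) {ω : Forms lam}
    (hω : ω ∈ formFilt lam k (n + 1)) :
    homotopy (d lam ω) + d lam (homotopy ω) - ((n + k : ℂ) • ω - thetaPart lam ω)
      ∈ formFilt lam k n := by
  change (homotopy ∘ₗ d lam + d lam ∘ₗ homotopy
    - ((n + k : ℂ) • LinearMap.id - thetaPart lam) : Forms lam →ₗ[ℂ] Forms lam) ω ∈ _
  refine map_mem_of_mem_formFilt _ (fun m hm f hf => ?_) hω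
  have h : form lam m (euler f) + (k : ℂ) • form lam m f - form lam (thetaProj m) f
        + ∑ a, wedgeLeft lam (contr (pauliDual a) m)
            (oneForm (((lam / 2) • pauli a) ⊗ₜ 1 * grad lam f))
        - ((n + k : ℂ) • form lam m f - form lam (thetaProj m) f)
      = form lam m (euler f - (n : ℂ) • f)
        + ∑ a, wedgeLeft lam (contr (pauliDual a) m)
            (oneForm (((lam / 2) • pauli a) ⊗ₜ 1 * grad lam f)) := by
    rw [map_sub, map_smul, add_smul]
    abel
  have h' : (homotopy ∘ₗ d lam + d lam ∘ₗ homotopy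
        - ((n + k : ℂ) • LinearMap.id - thetaPart lam) : Forms lam →ₗ[ℂ] Forms lam) (form lam m f)
      = homotopy (d lam (form lam m f)) + d lam (homotopy (form lam m f))
        - ((n + k : ℂ) • form lam m f - form lam (thetaProj m) f) := rfl
  rw [h', homotopy_d_add_d_homotopy_form hlam k hm, h]
  refine Submodule.add_mem _ (form_mem_formFilt hm (euler_sub_mem_filt hlam n hf))
    (Submodule.sum_mem _ fun a _ => ?_)
  refine map_mem_of_mem_matFilt ((wedgeLeft lam (contr (pauliDual a) m)) ∘ₗ oneForm)
    (fun v g hg => ?_) (tmul_one_mul_mem_matFilt _ (grad_mem_matFilt hlam n hf))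
  exact form_mem_formFilt (contr_mul_ι_mem _ _ k hm) hg

/-- A closed form is exact up to a form with coefficients of lower degree. -/
lemma exists_sub_d_mem_formFilt (hlam : lam ≠ 0) (k n : ℕ) (hnk : n + k ≠ 0) {ω : Forms lam}
    (hω : ω ∈ formFilt lam (k + 1) (n + 1)) (hd : d lam ω = 0) :
    ∃ η ∈ kForms lam k, ω - d lam η ∈ formFilt lam (k + 1) n := by
  have hh := homotopy_mem_kForms k (formFilt_le_kForms _ _ hω)
  have hh' := homotopy_mem_kForms k (d_mem lam k hh)
  -- The form degree is `k + 1`, so the leading part of the anticommutator is `L = (N + 1) - P`,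
  -- with possible eigenvalues `N` and `N + 1`.
  set N : ℂ := n + k with hN
  have hN0 : N ≠ 0 := by rw [hN]; exact_mod_cast hnk
  have hN1 : N + 1 ≠ 0 := by rw [hN]; exact_mod_cast (n + k).succ_ne_zero
  have hNk : (n + (k + 1 : ℕ) : ℂ) = N + 1 := by rw [hN]; push_cast; ring
  have h1 := homotopy_d_add_d_homotopy_sub_mem hlam (k + 1) n hω
  rw [hd, map_zero, zero_add, hNk] at h1
  -- Since `d (homotopy ω)` agrees with `L ω` modulo lower degree, it stays in the same filtration
  -- step and the congruence can be applied to it again.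
  have hL : d lam (homotopy ω) ∈ formFilt lam (k + 1) (n + 1) := by
    have hle : formFilt lam (k + 1) n ≤ formFilt lam (k + 1) (n + 1) :=
      Submodule.map₂_le_map₂_right (filt_le_succ lam n)
    have := Submodule.add_mem _ (hle h1) (Submodule.sub_mem _
      (Submodule.smul_mem _ (N + 1) hω) (thetaPart_mem_formFilt hω))
    rwa [sub_add_cancel] at this
  have h2 := homotopy_d_add_d_homotopy_sub_mem hlam (k + 1) n hL
  rw [d_d_of_mem lam k hh, map_zero, zero_add, hNk] at h2
  have h3 := thetaPart_mem_formFilt h1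
  rw [map_sub, map_sub, map_smul, thetaPart_thetaPart] at h3
  -- As `P` is idempotent, `L² - (2N + 1) L + N (N + 1) = 0`, hence `L⁻¹ L ω = (N (N + 1))⁻¹ ((2N +
  -- 1) L ω - L² ω)`; each `L` is replaced by `d ∘ homotopy`.
  refine ⟨(N * (N + 1))⁻¹ • ((2 * N + 1) • homotopy ω - homotopy (d lam (homotopy ω))),
    Submodule.smul_mem _ _ (Submodule.sub_mem _ (Submodule.smul_mem _ _ hh) hh'), ?_⟩
  have key : ω - d lam ((N * (N + 1))⁻¹ •
      ((2 * N + 1) • homotopy ω - homotopy (d lam (homotopy ω))))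
      = (N * (N + 1))⁻¹ • ((d lam (homotopy (d lam (homotopy ω)))
          - ((N + 1) • d lam (homotopy ω) - thetaPart lam (d lam (homotopy ω))))
        - (thetaPart lam (d lam (homotopy ω))
          - ((N + 1) • thetaPart lam ω - thetaPart lam ω))
        - N • (d lam (homotopy ω) - ((N + 1) • ω - thetaPart lam ω))) := by
    rw [map_smul, map_sub, map_smul]
    match_scalars <;> field_simp <;> ring
  rw [key]
  exact Submodule.smul_mem _ _
    (Submodule.sub_mem _ (Submodule.sub_mem _ h2 h3) (Submodule.smul_mem _ _ h1))

/-! ### The cohomology -/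

variable (lam) in
/-- The projection of the space of forms on `ℝ³_λ` by the augmentation of the exterior algebra. -/
def augment : Forms lam →ₗ[ℂ] R3 lam :=
  TensorProduct.lift ((LinearMap.lsmul ℂ (R3 lam)).comp
    (ExteriorAlgebra.algebraMapInv (R := ℂ) (M := M2)).toLinearMap)

lemma form_one_injective : Function.Injective (form lam 1) := by
  refine Function.LeftInverse.injective (g := augment lam) fun f => ?_
  change (ExteriorAlgebra.algebraMapInv (R := ℂ) (M := M2) 1) • f = f
  rw [map_one, one_smul]

variable (lam) in
lemma one_ne_zero_R3 : (1 : R3 lam) ≠ 0 := fun h => by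
  have := congrArg (counit lam) h
  simp at this

lemma theta_eq_form : theta lam = form lam (ExteriorAlgebra.ι ℂ 1) 1 := rfl

-- Contraction with `thetaDual` followed by augmentation sends `θ` to `1`, which the counit shows to
-- be nonzero.
variable (lam) in
lemma theta_ne_zero : theta lam ≠ 0 := by
  intro h
  have h' := congrArg (augment lam ∘ formMap (contr thetaDual) LinearMap.id) h
  have hc : contr thetaDual (ExteriorAlgebra.ι ℂ 1) = 1 := by
    have := contr_mul_ι thetaDual 1 1
    rwa [one_mul, thetaDual_one, one_smul, contr_one, zero_mul, sub_zero] at this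
  rw [theta_eq_form, Function.comp_apply, formMap_form, hc, Function.comp_apply, map_zero,
    map_zero] at h'
  refine one_ne_zero_R3 lam ?_
  rw [← h']
  change _ = (ExteriorAlgebra.algebraMapInv (R := ℂ) (M := M2) 1) • (1 : R3 lam)
  rw [map_one, one_smul]

/-- The Euler vector field has no component along `θ`. -/
lemma homotopy_theta : homotopy (theta lam) = 0 := by
  have h := homotopy_wedgeLeft_oneForm (lam := lam) 1 ((1 : M2) ⊗ₜ 1)
  simpa [theta_eq_form, pauliDual_one, contr_one] using h

/-- For functions `homotopy ∘ d` is exactly `euler`. Assuming less than closedness lets the same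
lemma handle primitives of `θ`. -/
lemma exists_eq_smul_one_of_homotopy_d (hlam : lam ≠ 0) {ω : Forms lam} (hω : ω ∈ kForms lam 0)
    (h : homotopy (d lam ω) = 0) : ∃ c : ℂ, ω = c • (1 : Forms lam) := by
  obtain ⟨f, rfl⟩ : ∃ f, form lam 1 f = ω := by
    have hle : kForms lam 0 ≤ LinearMap.range (form lam 1) := by
      refine Submodule.span_le.mpr ?_
      rintro _ ⟨m, hm, f, rfl⟩
      rw [ExteriorAlgebra.exteriorPower, pow_zero] at hm
      obtain ⟨c, rfl⟩ := Submodule.mem_one.mp hm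
      exact ⟨c • f, by
        rw [ofBasic_mul_ofFun, Algebra.algebraMap_eq_smul_one, map_smul, map_smul,
          LinearMap.smul_apply]⟩
    exact hle hω
  rw [d_form_eq, homotopy_wedgeLeft_oneForm] at h
  simp only [contr_one, map_zero, LinearMap.zero_apply, Finset.sum_const_zero,
    sub_zero] at h
  obtain ⟨c, rfl⟩ := exists_eq_smul_one_of_euler_eq_zero hlam
    (form_one_injective (h.trans (map_zero _).symm))
  exact ⟨c, map_smul _ _ _⟩

lemma exists_eq_d_of_closed (hlam : lam ≠ 0) (k : ℕ) {ω : Forms lam}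
    (hω : ω ∈ kForms lam (k + 2)) (hd : d lam ω = 0) : ∃ η ∈ kForms lam (k + 1), d lam η = ω := by
  obtain ⟨n, hn⟩ := exists_mem_formFilt _ hω
  clear hω
  induction n generalizing ω with
  | zero =>
    rw [formFilt, filt, Submodule.map₂_bot_right, Submodule.mem_bot] at hn
    exact ⟨0, Submodule.zero_mem _, by rw [hn, map_zero]⟩
  | succ n ih =>
    -- Here `N = n + (k + 1)` never vanishes, so the descent reaches `filt lam 0 = ⊥`.
    obtain ⟨η, hη, h⟩ := exists_sub_d_mem_formFilt hlam (k + 1) n (by omega) hn hd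
    obtain ⟨ζ, hζ, h'⟩ := ih (by rw [map_sub, hd, d_d_of_mem lam _ hη, sub_zero]) h
    exact ⟨η + ζ, Submodule.add_mem _ hη hζ, by rw [map_add, h', add_sub_cancel]⟩

lemma exists_eq_d_add_theta_of_basic (hlam : lam ≠ 0) {ω : Forms lam}
    (hω : ω ∈ formFilt lam 1 1) :
    ∃ c : ℂ, ∃ η ∈ kForms lam 0, ω = d lam η + c • theta lam := by
  let p : Submodule ℂ (Forms lam) := (kForms lam 0).map (d lam) ⊔ (ℂ ∙ theta lam)
  suffices h : ω ∈ p by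
    obtain ⟨_, ⟨η, hη, rfl⟩, _, hc, rfl⟩ := Submodule.mem_sup.mp h
    obtain ⟨c, rfl⟩ := Submodule.mem_span_singleton.mp hc
    exact ⟨c, η, hη, rfl⟩
  refine map_mem_of_mem_formFilt LinearMap.id (fun m hm f hf => ?_) hω
  obtain ⟨c, rfl⟩ := mem_filt_one hf
  rw [ExteriorAlgebra.exteriorPower, pow_one] at hm
  obtain ⟨v, rfl⟩ := hm
  have hv : form lam (ExteriorAlgebra.ι ℂ v) 1
      = ∑ a, pauliDual a v • d lam (ofFun lam (x lam a)) + thetaDual v • theta lam := by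
    have h := sum_pauliDual_smul v
    rw [eq_sub_iff_add_eq] at h
    have h' := congrArg (fun w => basicOneForm lam w) h
    simp only [basicOneForm, map_add, map_sum, map_smul] at h'
    simp only [d_x lam hlam, basicOneForm, map_smul]
    exact h'.symm
  rw [LinearMap.id_apply, map_smul, hv]
  refine Submodule.smul_mem _ _ (Submodule.add_mem _ (Submodule.sum_mem _ fun a _ => ?_) ?_)
  · refine Submodule.smul_mem _ _ (Submodule.mem_sup_left ⟨_, ?_, rfl⟩)
    exact Submodule.subset_span ⟨1, by simp [Submodule.mem_one], x lam a, by simp⟩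
  · exact Submodule.smul_mem _ _ (Submodule.mem_sup_right (Submodule.mem_span_singleton_self _))

lemma exists_eq_d_add_theta_of_closed (hlam : lam ≠ 0) {ω : Forms lam}
    (hω : ω ∈ kForms lam 1) (hd : d lam ω = 0) :
    ∃ c : ℂ, ∃ η ∈ kForms lam 0, ω = d lam η + c • theta lam := by
  obtain ⟨n, hn⟩ := exists_mem_formFilt _ hω
  -- The descent must stop at constant coefficients, filtration index 1, because `N = 0` there; the
  -- index is raised so that the induction starts at that case.
  replace hn : ω ∈ formFilt lam 1 (n + 1) := Submodule.map₂_le_map₂_right (filt_le_succ lam n) hn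
  clear hω
  induction n generalizing ω with
  | zero => exact exists_eq_d_add_theta_of_basic hlam hn
  | succ n ih =>
    obtain ⟨η, hη, h⟩ := exists_sub_d_mem_formFilt hlam 0 (n + 1) (by omega) hn hd
    obtain ⟨c, ζ, hζ, h'⟩ := ih (by rw [map_sub, hd, d_d_of_mem lam _ hη, sub_zero]) h
    refine ⟨c, η + ζ, Submodule.add_mem _ hη hζ, ?_⟩
    rw [map_add, add_assoc, ← h', add_sub_cancel]

lemma deRhamClass_eq_zero_iff {k : ℕ} {ω : Forms lam} (hω : ω ∈ closedForms lam k) :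
    deRhamClass lam ω hω = 0 ↔ ω ∈ exactForms lam k := by
  rw [deRhamClass, Submodule.Quotient.mk_eq_zero]
  rfl

lemma span_deRhamClass_eq_top {k : ℕ} {ω : Forms lam} (hω : ω ∈ closedForms lam k)
    (h : ∀ η ∈ closedForms lam k, ∃ c : ℂ, η - c • ω ∈ exactForms lam k) :
    Submodule.span ℂ {deRhamClass lam ω hω} = ⊤ := by
  refine eq_top_iff.mpr fun q _ => ?_
  obtain ⟨⟨η, hη⟩, rfl⟩ := Submodule.Quotient.mk_surjective _ q
  obtain ⟨c, hc⟩ := h η hη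
  refine Submodule.mem_span_singleton.mpr ⟨c, Eq.symm ?_⟩
  exact (Submodule.Quotient.eq _).mpr hc

lemma subsingleton_deRham (hlam : lam ≠ 0) (k : ℕ) : Subsingleton (deRham lam (k + 2)) := by
  refine Submodule.Quotient.subsingleton_iff.mpr (eq_top_iff.mpr ?_)
  rintro ⟨ω, hω⟩ _
  obtain ⟨η, hη, h⟩ := exists_eq_d_of_closed hlam k hω.1 hω.2
  exact ⟨η, hη, h⟩

end QuantumR3

end

theorem mainTheorem1 (lam : ℂ) (hlam : lam ≠ 0) :
    (QuantumR3.deRhamClass lam 1 (QuantumR3.one_mem_closedForms lam) ≠ 0 ∧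
      Submodule.span ℂ {QuantumR3.deRhamClass lam 1 (QuantumR3.one_mem_closedForms lam)} = ⊤) ∧
    (QuantumR3.deRhamClass lam (QuantumR3.theta lam) (QuantumR3.theta_mem_closedForms lam) ≠ 0 ∧
      Submodule.span ℂ {QuantumR3.deRhamClass lam (QuantumR3.theta lam)
        (QuantumR3.theta_mem_closedForms lam)} = ⊤) ∧
    Subsingleton (QuantumR3.deRham lam 2) ∧
    Subsingleton (QuantumR3.deRham lam 3) ∧
    Subsingleton (QuantumR3.deRham lam 4) := by
  open QuantumR3 in
  refine ⟨⟨fun h => ?_, span_deRhamClass_eq_top _ fun η hη => ?_⟩,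
    ⟨fun h => ?_, span_deRhamClass_eq_top _ fun η hη => ?_⟩,
    subsingleton_deRham hlam 0, subsingleton_deRham hlam 1, subsingleton_deRham hlam 2⟩
  · have h1 := (Submodule.mem_bot ℂ).mp ((deRhamClass_eq_zero_iff _).mp h)
    exact one_ne_zero_R3 lam (form_one_injective (h1.trans (map_zero _).symm))
  · have hd : d lam η = 0 := hη.2
    obtain ⟨c, rfl⟩ := exists_eq_smul_one_of_homotopy_d hlam hη.1 (by rw [hd, map_zero])
    exact ⟨c, by rw [sub_self]; exact Submodule.zero_mem _⟩
  · obtain ⟨η, hη, hd⟩ := (deRhamClass_eq_zero_iff _).mp h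
    -- A primitive `η` of `θ` satisfies `homotopy (d η) = homotopy θ = 0`, so it is constant and `θ
    -- = d η = 0`.
    obtain ⟨c, rfl⟩ := exists_eq_smul_one_of_homotopy_d hlam hη (by rw [hd, homotopy_theta])
    have h1 : d lam 1 = 0 := (one_mem_closedForms lam).2
    exact theta_ne_zero lam (by rw [← hd, map_smul, h1, smul_zero])
  · obtain ⟨c, ζ, hζ, rfl⟩ := exists_eq_d_add_theta_of_closed hlam hη.1 hη.2
    exact ⟨c, ζ, hζ, (add_sub_cancel_right _ _).symm⟩
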